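/- Let $N\ge 1$ and $n\ge 0$ be integers, let $x,x_1,\dots,x_n\in\mathbb C$ with $x\neq x_i$ for all $i$, and let $h$ be a complex $N\times N$ matrix. For a diagram $\lambda=(\lambda_1\ge\dots\ge\lambda_\ell>0)$ let $\chi_\lambda(h)=\det_{1\le i,j\le \ell}\bigl(h_{\lambda_i-i+j}\bigr)$ be the $GL(N)$ character (Schur polynomial), where $\exp\bigl(\sum_{k\ge1}\tfrac1k\operatorname{tr}(h^k)z^k\bigr)=\sum_{k\ge0}h_kz^k$ and $h_k=0$ for $k<0$. For a function $F$ of $h$ with values in $\operatorname{End}\bigl((\mathbb C^N)^{\otimes m}\bigr)$ let the co-derivative be $$\mathsf d_{m+1}F(h)=\frac{\partial}{\partial\varepsilon}\sum_{a,b=1}^N F(h+\varepsilon e_{ba})\otimes e_{ab}\Big|_{\varepsilon=0}\in\operatorname{End}\bigl((\mathbb C^N)^{\otimes (m+1)}\bigr),$$ where $e_{ab}$ are the matrix units. The Gaudin transfer matrices on $n$ sites are $$\mathsf T^{G,n}_\lambda(x)=\Bigl(1+\frac{\mathsf d_n}{x-x_n}\Bigr)\cdots\Bigl(1+\frac{\mathsf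 d_1}{x-x_1}\Bigr)\chi_\lambda(h)$$ (the $i$-th factor maps $F$ to $F\otimes \mathbb I+\frac{1}{x-x_i}\mathsf d_iF$), and $\mathsf T^{G,n}_{\alpha,\beta}=\mathsf T^{G,n}_{(\alpha+1,1^\beta)}$ for $\alpha,\beta\ge0$. Then the semi-infinite matrix $(M_{\alpha\beta})_{\alpha,\beta\ge0}$ with $M_{\alpha\beta}=\mathsf d_{n+1}\mathsf T^{G,n}_{\alpha,\beta}(x)\in\operatorname{End}\bigl((\mathbb C^N)^{\otimes(n+1)}\bigr)$ has rank $1$. That is: its entries commute with each other, so that its minors are well defined; some entry is an invertible operator (so the rank is not $0$, not even on a common eigenvector of the entries); and all its $2\times2$ minors vanish, $$M_{\alpha_1\beta_1}M_{\alpha_2\beta_2}-M_{\alpha_1\beta_2}M_{\alpha_2\beta_1}=0\qquad\text{for all }\alpha_1,\alpha_2,\beta_1,\beta_2\ge0 .$$ -/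

import Mathlib

/-- Operators on `(ℂ^N)^{⊗ n}`, as matrices in the standard tensor basis, which is indexed by
`Fin n → Fin N`. -/
abbrev SiteOp (N n : ℕ) : Type := Matrix (Fin n → Fin N) (Fin n → Fin N) ℂ

/-- The power series `ξ(y, z) = ∑_{k ≥ 1} y_k z^k` with `y_k = tr (h^k) / k`. -/
noncomputable def xiSeries {N : ℕ} (h : Matrix (Fin N) (Fin N) ℂ) : PowerSeries ℂ :=
  PowerSeries.mk fun k => if k = 0 then 0 else Matrix.trace (h ^ k) / (k : ℂ)

/-- The complete symmetric polynomial `h_k(y)`, given by `exp (ξ(y, z)) = ∑_{k ≥ 0} h_k(y) z^k`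
and by `h_k(y) = 0` for `k < 0`. -/
noncomputable def completeSym {N : ℕ} (k : ℤ) (h : Matrix (Fin N) (Fin N) ℂ) : ℂ :=
  if k < 0 then 0
  else PowerSeries.coeff k.toNat ((PowerSeries.exp ℂ).subst (xiSeries h))

/-- The `GL(N)` character `χ_λ` of the diagram with rows `lam 0 ≥ lam 1 ≥ …`, as a polynomial
function of `h ∈ gl(N)` (Jacobi-Trudi formula `det h_{λ_i - i + j}`). -/
noncomputable def schurChar {N l : ℕ} (lam : Fin l → ℕ) (h : Matrix (Fin N) (Fin N) ℂ) : ℂ :=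
  Matrix.det (Matrix.of fun i j : Fin l =>
    completeSym ((lam i : ℤ) - (i : ℤ) + (j : ℤ)) h)

/-- The rows of the hook diagram `(α + 1, 1^β)`. -/
def hookRows (α β : ℕ) : Fin (β + 1) → ℕ := Fin.cons (α + 1) fun _ => 1

/-- `A ↦ A ⊗ 𝟙`: an operator on `n` sites, extended by the identity on the site `n + 1`. -/
def tensorOne {N n : ℕ} (A : SiteOp N n) : SiteOp N (n + 1) :=
  Matrix.of fun I J =>
    A (Fin.init I) (Fin.init J) *
      (1 : Matrix (Fin N) (Fin N) ℂ) (I (Fin.last n)) (J (Fin.last n))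

/-- The co-derivative
`d_{n+1} F (h) = ∂/∂ε ∑_{a b} F (h + ε e_{ba}) ⊗ e_{ab}` at `ε = 0`, with `e_{ab}` acting on the
site `n + 1`. Its coefficient at `e_{ab}` sits at the entries `(I, J)` whose last components are
`a` and `b`, respectively. -/
noncomputable def coDeriv {N n : ℕ} (F : Matrix (Fin N) (Fin N) ℂ → SiteOp N n)
    (h : Matrix (Fin N) (Fin N) ℂ) : SiteOp N (n + 1) :=
  Matrix.of fun I J =>
    deriv (fun ε : ℂ =>
      F (h + ε • Matrix.single (J (Fin.last n)) (I (Fin.last n)) (1 : ℂ))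
        (Fin.init I) (Fin.init J)) 0

/-- `(1 + d_n / (x - x_n)) ⋯ (1 + d_1 / (x - x_1)) f`, for a scalar function `f` on `gl(N)`. -/
noncomputable def siteProduct {N : ℕ} (x : ℂ) (f : Matrix (Fin N) (Fin N) ℂ → ℂ) :
    (n : ℕ) → (Fin n → ℂ) → Matrix (Fin N) (Fin N) ℂ → SiteOp N n
  | 0, _ => fun h => f h • (1 : SiteOp N 0)
  | n + 1, xs => fun h =>
      tensorOne (siteProduct x f n (Fin.init xs) h) +
        (x - xs (Fin.last n))⁻¹ • coDeriv (siteProduct x f n (Fin.init xs)) h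

/-- The Gaudin transfer matrix `T^{G,n}_λ(x)` with marked points `xs`, as a function of the twist
matrix. -/
noncomputable def gaudinT {N n l : ℕ} (lam : Fin l → ℕ) (x : ℂ) (xs : Fin n → ℂ) :
    Matrix (Fin N) (Fin N) ℂ → SiteOp N n :=
  siteProduct x (schurChar lam) n xs

/-- The semi-infinite matrix `(d_{n+1} T^{G,n}_{α,β}(x))_{α,β ≥ 0}` at the twist matrix `h`, where
`T^{G,n}_{α,β} = T^{G,n}_{(α+1, 1^β)}`. -/
noncomputable def hookCoDerivMatrix {N n : ℕ} (x : ℂ) (xs : Fin n → ℂ)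
    (h : Matrix (Fin N) (Fin N) ℂ) : Matrix ℕ ℕ (SiteOp N (n + 1)) :=
  Matrix.of fun α β => coDeriv (gaudinT (hookRows α β) x xs) h

/-! The matrix factorises: `M α β = P α * Q β`, where all the `P α` and `Q β` commute with each
other. Commutation of the entries and vanishing of the 2×2 minors are then formal, and `P 0 = Q 0 =
1` makes the corner entry the identity. For `n = 0` this is a computation of gradients. Let `X` be
the generic matrix, with `h_k`, `e_k` its complete and elementary symmetric polynomials. The
gradients of `h_{α+1}` and `e_{β+1}` are the coefficients `R_α`, `C_β` of `H(z)(1 - zX)⁻¹` and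
`E(z)(1 + zX)⁻¹`, and the hook character has gradient `R_α C_β` (`matGrad_hookPoly`). Since partial
derivatives commute, the co-derivative on the site `n + 1` can be taken first, and it remains to
apply the site operators to `R_α C_β`. A factor `1 + u d` fails to be multiplicative only by `u² dF
dG` (`siteStep_mul`). For `F = R_α`, `G = C_β` this defect vanishes: `dR_α` is fixed by the swap of
its two sites, `dC_β` is negated, so `dR_α dC_β = 0`, and likewise after further co-derivatives.
Hence the site operators split the product (`siteChain_mul`), in either order, so the `P α` commute
with the `Q β`. The `P α` commute among themselves, and so do the `Q β`, because all iterated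
co-derivatives of the generating series `G w`, `w = (1 - εzX)⁻¹`, are a scalar series times a tensor
power of `w` times a constant operator commuting with it (`FusionData`). Coefficients of such series
commute, and the site operators preserve this. -/

open scoped Kronecker

/-! ### Algebraic co-derivatives and the defect of multiplicativity -/

section CoDerivation

variable {a A K : Type} [CommRing A] [Algebra ℂ A]

/-- The co-derivative of a matrix, with respect to a square array of derivations. -/
def coder (D : a → a → Derivation ℂ A A) (F : Matrix K K A) : Matrix (K × a) (K × a) A :=
  Matrix.of fun p q => D q.2 p.2 (F p.1 q.1)

/-- Exchange of the last two sites. -/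
def siteSwap (K a : Type) : (K × a) × a ≃ (K × a) × a where
  toFun p := ((p.1.1, p.2), p.1.2)
  invFun p := ((p.1.1, p.2), p.1.2)
  left_inv _ := rfl
  right_inv _ := rfl

variable (D : a → a → Derivation ℂ A A)

theorem coder_apply (F : Matrix K K A) (p q : K × a) :
    coder D F p q = D q.2 p.2 (F p.1 q.1) := rfl

theorem coder_add (F G : Matrix K K A) : coder D (F + G) = coder D F + coder D G := by
  ext; simp [coder_apply]

theorem coder_smul (c : ℂ) (F : Matrix K K A) : coder D (c • F) = c • coder D F := by
  ext; simp [coder_apply]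

theorem coder_neg (F : Matrix K K A) : coder D (-F) = -coder D F := by
  ext; simp [coder_apply]

theorem coder_one [DecidableEq K] : coder D (1 : Matrix K K A) = 0 := by
  ext p q
  by_cases h : p.1 = q.1 <;> simp [coder_apply, Matrix.one_apply, h]

variable [DecidableEq a]

/-- The operator `F ↦ F ⊗ 1 + u d F`. -/
def siteStep (u : ℂ) (F : Matrix K K A) : Matrix (K × a) (K × a) A :=
  F ⊗ₖ (1 : Matrix a a A) + u • coder D F

theorem siteStep_smul (u c : ℂ) (F : Matrix K K A) :
    siteStep D u (c • F) = c • siteStep D u F := by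
  rw [siteStep, siteStep, coder_smul, Matrix.smul_kronecker, smul_add, smul_comm]

theorem coder_kronecker_one (F : Matrix K K A) :
    coder D (F ⊗ₖ (1 : Matrix a a A)) =
      (coder D F ⊗ₖ (1 : Matrix a a A)).submatrix (siteSwap K a) (siteSwap K a) := by
  ext ⟨⟨k, i⟩, j⟩ ⟨⟨k', i'⟩, j'⟩
  by_cases h : i = i' <;> simp [coder_apply, siteSwap, h]

/-- Partial derivatives commute, so two co-derivatives can be exchanged at the cost of relabelling
the sites they create. -/
theorem coder_siteStep (hD : ∀ i j i' j' x, D i j (D i' j' x) = D i' j' (D i j x))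
    (u : ℂ) (F : Matrix K K A) :
    coder D (siteStep D u F) =
      (siteStep D u (coder D F)).submatrix (siteSwap K a) (siteSwap K a) := by
  rw [siteStep, coder_add, coder_kronecker_one, coder_smul]
  ext ⟨⟨k, i⟩, j⟩ ⟨⟨k', i'⟩, j'⟩
  simp [siteStep, coder_apply, siteSwap, hD j' j]

variable [Fintype a] [Fintype K]

theorem coder_mul (F G : Matrix K K A) :
    coder D (F * G) = coder D F * (G ⊗ₖ 1) + (F ⊗ₖ 1) * coder D G := by
  ext ⟨k, i⟩ ⟨k', j⟩
  simp only [coder_apply, Matrix.mul_apply, Matrix.add_apply, map_sum, Derivation.leibniz,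
    Fintype.sum_prod_type, Matrix.kronecker_apply, Matrix.one_apply, mul_ite, ite_mul, mul_one,
    mul_zero, zero_mul, Finset.sum_ite_eq, Finset.sum_ite_eq', Finset.mem_univ, if_true,
    smul_eq_mul, Finset.sum_add_distrib]
  rw [add_comm]
  congr 1
  exact Finset.sum_congr rfl fun _ _ => mul_comm _ _

/-- By the Leibniz rule the terms of order 0 and 1 in `u` agree; only the quadratic term is left
over. -/
theorem siteStep_mul (u : ℂ) (F G : Matrix K K A) :
    siteStep D u F * siteStep D u G =
      siteStep D u (F * G) + (u * u) • (coder D F * coder D G) := by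
  have h : (F * G) ⊗ₖ (1 : Matrix a a A) = (F ⊗ₖ 1) * (G ⊗ₖ 1) := by
    rw [← Matrix.mul_kronecker_mul, one_mul]
  simp only [siteStep, coder_mul, h, add_mul, mul_add, smul_mul_assoc, mul_smul_comm, smul_add,
    smul_smul]
  abel

end CoDerivation

/-! ### Exchange relations stable under the site operators -/

section TwistedCommute

variable {a A : Type} [CommRing A] [Algebra ℂ A] [Fintype a]

/-- The relation `F G = s G F` for the `m`-fold co-derivatives of `F` and `G`. -/
def TwistedCommuteAt (D : a → a → Derivation ℂ A A) (s : ℂ) :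
    ℕ → ∀ {K : Type} [Fintype K], Matrix K K A → Matrix K K A → Prop
  | 0, _, _, F, G => F * G = s • (G * F)
  | m + 1, _, _, F, G => TwistedCommuteAt D s m (coder D F) (coder D G)

variable (D : a → a → Derivation ℂ A A) (s : ℂ)

theorem TwistedCommuteAt.submatrix (m : ℕ) {K K' : Type} [Fintype K] [Fintype K']
    {F G : Matrix K K A} (h : TwistedCommuteAt D s m F G) (e : K' ≃ K) :
    TwistedCommuteAt D s m (F.submatrix e e) (G.submatrix e e) := by
  induction m generalizing K K' with
  | zero =>
    have h' : F * G = s • (G * F) := h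
    change F.submatrix e e * G.submatrix e e = s • (G.submatrix e e * F.submatrix e e)
    rw [Matrix.submatrix_mul_equiv, Matrix.submatrix_mul_equiv, h', Matrix.submatrix_smul]
    rfl
  | succ m ih => exact ih (F := coder D F) (G := coder D G) h (e.prodCongr (Equiv.refl a))

/-- Both terms of `siteStep_mul` pick up the factor `s` on exchange: the first by the relation for
`F`, `G`, the second by that for their co-derivatives. This is why the relation is required at every
order. The cases used are `s = 0` (vanishing product) and `s = 1` (commutation). -/
theorem TwistedCommuteAt.siteStep [DecidableEq a]
    (hD : ∀ i j i' j' x, D i j (D i' j' x) = D i' j' (D i j x))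
    (u : ℂ) (m : ℕ) {K : Type} [Fintype K] {F G : Matrix K K A}
    (h : ∀ m, TwistedCommuteAt D s m F G) :
    TwistedCommuteAt D s m (siteStep D u F) (siteStep D u G) := by
  induction m generalizing K with
  | zero =>
    have h₀ : F * G = s • (G * F) := h 0
    have h₁ : coder D F * coder D G = s • (coder D G * coder D F) := h 1
    change _ = s • _
    rw [siteStep_mul, siteStep_mul, h₀, h₁, siteStep_smul, smul_add, smul_comm]
  | succ m ih =>
    change TwistedCommuteAt D s m (coder D _) (coder D _)
    rw [coder_siteStep D hD, coder_siteStep D hD]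
    exact (ih fun m => h (m + 1)).submatrix D s m (siteSwap K a)

end TwistedCommute

/-! ### Chains of site operators and their multiplicativity -/

section SiteOperators

variable {a A K : Type} [CommRing A] [Algebra ℂ A] [DecidableEq a]

/-- The matrix element of `(1 + u_n d_n) ⋯ (1 + u_1 d_1)` between `I` and `J`, as an operator on
functions. -/
def siteOperator (D : a → a → Derivation ℂ A A) :
    (n : ℕ) → (Fin n → ℂ) → (Fin n → a) → (Fin n → a) → A →ₗ[ℂ] A
  | 0, _, _, _ => LinearMap.id
  | n + 1, u, I, J =>
    ((if I (Fin.last n) = J (Fin.last n) then 1 else 0 : ℂ) • LinearMap.id +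
      u (Fin.last n) • (D (J (Fin.last n)) (I (Fin.last n))).toLinearMap) ∘ₗ
      siteOperator D n (Fin.init u) (Fin.init I) (Fin.init J)

/-- The operator `(1 + u_n d_n) ⋯ (1 + u_1 d_1)` on matrices. -/
def siteChain (D : a → a → Derivation ℂ A A) (n : ℕ) (u : Fin n → ℂ) (F : Matrix K K A) :
    Matrix (K × (Fin n → a)) (K × (Fin n → a)) A :=
  Matrix.of fun p q => siteOperator D n u p.2 q.2 (F p.1 q.1)

variable (D : a → a → Derivation ℂ A A)

theorem siteOperator_comm (hD : ∀ i j i' j' x, D i j (D i' j' x) = D i' j' (D i j x))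
    (n : ℕ) (u : Fin n → ℂ) (I J : Fin n → a) (i j : a) (x : A) :
    D i j (siteOperator D n u I J x) = siteOperator D n u I J (D i j x) := by
  induction n with
  | zero => rfl
  | succ n ih =>
    by_cases h : I (Fin.last n) = J (Fin.last n) <;> simp [siteOperator, ← ih, hD i j, h]

/-- Splitting off the last site. -/
def lastSite (K a : Type) (n : ℕ) : K × (Fin (n + 1) → a) ≃ (K × (Fin n → a)) × a where
  toFun p := ((p.1, Fin.init p.2), p.2 (Fin.last n))
  invFun p := (p.1.1, Fin.snoc p.1.2 p.2)
  left_inv p := by simp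
  right_inv p := by simp

theorem siteChain_zero (u : Fin 0 → ℂ) (F : Matrix K K A) :
    siteChain D 0 u F = F.submatrix (Equiv.prodUnique K (Fin 0 → a))
      (Equiv.prodUnique K (Fin 0 → a)) := rfl

theorem siteChain_succ (n : ℕ) (u : Fin (n + 1) → ℂ) (F : Matrix K K A) :
    siteChain D (n + 1) u F =
      (siteStep D (u (Fin.last n)) (siteChain D n (Fin.init u) F)).submatrix
        (lastSite K a n) (lastSite K a n) := by
  ext ⟨k, I⟩ ⟨k', J⟩
  by_cases h : I (Fin.last n) = J (Fin.last n) <;>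
  simp [siteChain, siteStep, siteOperator, lastSite, coder_apply, h]

theorem siteChain_one [DecidableEq K] (n : ℕ) (u : Fin n → ℂ) :
    siteChain D n u (1 : Matrix K K A) = 1 := by
  induction n with
  | zero => rw [siteChain_zero, Matrix.submatrix_one_equiv]
  | succ n ih =>
    rw [siteChain_succ, ih, siteStep, coder_one, smul_zero, add_zero, Matrix.one_kronecker_one,
      Matrix.submatrix_one_equiv]

variable [Fintype a] [Fintype K]

theorem twistedCommuteAt_siteChain
    (hD : ∀ i j i' j' x, D i j (D i' j' x) = D i' j' (D i j x)) (s : ℂ) (m n : ℕ)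
    (u : Fin n → ℂ) {F G : Matrix K K A} (h : ∀ m, TwistedCommuteAt D s m F G) :
    TwistedCommuteAt D s m (siteChain D n u F) (siteChain D n u G) := by
  induction n generalizing m with
  | zero => exact (h m).submatrix D s m (Equiv.prodUnique K (Fin 0 → a))
  | succ n ih =>
    rw [siteChain_succ, siteChain_succ]
    exact (TwistedCommuteAt.siteStep D s hD _ m fun m => ih m _).submatrix D s m (lastSite K a n)

theorem coder_siteChain_mul_eq_zero
    (hD : ∀ i j i' j' x, D i j (D i' j' x) = D i' j' (D i j x)) (n : ℕ)
    (u : Fin n → ℂ) {F G : Matrix K K A} (h : ∀ m, TwistedCommuteAt D 0 m (coder D F) (coder D G)) :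
    coder D (siteChain D n u F) * coder D (siteChain D n u G) = 0 := by
  have key := twistedCommuteAt_siteChain D hD 0 0 n u h
  have e : ∀ F : Matrix K K A, coder D (siteChain D n u F) =
      (siteChain D n u (coder D F)).submatrix
        (fun p => ((p.1.1, p.2), p.1.2)) (fun p => ((p.1.1, p.2), p.1.2)) := by
    intro F
    ext
    exact siteOperator_comm D hD ..
  have hk : siteChain D n u (coder D F) * siteChain D n u (coder D G) = 0 :=
    key.trans (zero_smul _ _)
  -- The site of the outer co-derivative moves in front of the chain, where the co-derivative acts
  -- first.
  let σ : (K × (Fin n → a)) × a ≃ (K × a) × (Fin n → a) :=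
    ⟨fun p => ((p.1.1, p.2), p.1.2), fun p => ((p.1.1, p.2), p.1.2), fun _ => rfl, fun _ => rfl⟩
  rw [e, e]
  change (siteChain D n u (coder D F)).submatrix σ σ *
    (siteChain D n u (coder D G)).submatrix σ σ = 0
  rw [Matrix.submatrix_mul_equiv, hk]
  rfl

/-- The quadratic defect at each added site is a product of co-derivatives of shorter chains, which
vanishes. -/
theorem siteChain_mul (hD : ∀ i j i' j' x, D i j (D i' j' x) = D i' j' (D i j x)) (n : ℕ)
    (u : Fin n → ℂ) {F G : Matrix K K A} (h : ∀ m, TwistedCommuteAt D 0 m (coder D F) (coder D G)) :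
    siteChain D n u (F * G) = siteChain D n u F * siteChain D n u G := by
  induction n with
  | zero =>
    rw [siteChain_zero, siteChain_zero, siteChain_zero, Matrix.submatrix_mul_equiv]
  | succ n ih =>
    rw [siteChain_succ, siteChain_succ, siteChain_succ, Matrix.submatrix_mul_equiv, siteStep_mul,
      coder_siteChain_mul_eq_zero D hD n _ h, smul_zero, add_zero, ih]

/-- If a constant matrix is absorbed by `F` from the right with eigenvalue `1` and by `G` from the
left with eigenvalue `-1`, then `F G = 0`, and likewise for all their co-derivatives. -/
theorem twistedCommuteAt_zero_of_absorb (m : ℕ) {F G C : Matrix K K A}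
    (hC : coder D C = 0) (hF : F * C = F) (hG : C * G = -G) :
    TwistedCommuteAt D 0 m F G := by
  induction m generalizing K with
  | zero =>
    change F * G = (0 : ℂ) • (G * F)
    have h₁ : F * G = -(F * G) := by
      calc F * G = F * C * G := by rw [hF]
        _ = -(F * G) := by rw [mul_assoc, hG, mul_neg]
    have h₂ : (2 : ℂ) • (F * G) = 0 := by
      rw [two_smul]
      nth_rewrite 1 [h₁]
      exact neg_add_cancel _
    rw [zero_smul]
    simpa [smul_smul] using congrArg ((2 : ℂ)⁻¹ • ·) h₂
  | succ m ih =>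
    -- As `C` is constant, differentiating `F C = F` and `C G = -G` gives the same relations with `C
    -- ⊗ 1`.
    refine ih (C := C ⊗ₖ 1) ?_ ?_ ?_
    · rw [coder_kronecker_one, hC, Matrix.zero_kronecker]
      rfl
    · have := coder_mul D F C
      rw [hC, mul_zero, add_zero, hF] at this
      exact this.symm
    · have := coder_mul D C G
      rw [hC, zero_mul, zero_add, hG, coder_neg] at this
      exact this.symm

end SiteOperators

/-! ### Derivations of power series and uniqueness for a linear ODE -/

section SeriesDerivation

variable {A : Type} [CommRing A] [Algebra ℂ A]

/-- The coefficientwise extension of a derivation to power series. -/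
noncomputable def seriesDeriv (d : Derivation ℂ A A) :
    Derivation ℂ (PowerSeries A) (PowerSeries A) :=
  Derivation.mk'
    { toFun := fun f => PowerSeries.mk fun n => d (PowerSeries.coeff n f)
      map_add' := fun f g => by ext; simp
      map_smul' := fun c f => by ext; simp }
    fun f g => by
      ext n
      simp only [LinearMap.coe_mk, AddHom.coe_mk, PowerSeries.coeff_mk, PowerSeries.coeff_mul,
        map_sum, Derivation.leibniz, smul_eq_mul, map_add, Finset.sum_add_distrib]
      congr 1
      exact (Finset.Nat.sum_antidiagonal_swap (n := n)
        (f := fun p => PowerSeries.coeff p.1 g * d (PowerSeries.coeff p.2 f)))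

theorem coeff_seriesDeriv (d : Derivation ℂ A A) (f : PowerSeries A) (n : ℕ) :
    PowerSeries.coeff n (seriesDeriv d f) = d (PowerSeries.coeff n f) :=
  PowerSeries.coeff_mk n fun n => d (PowerSeries.coeff n f)

theorem seriesDeriv_X_mul (d : Derivation ℂ A A) (f : PowerSeries A) :
    seriesDeriv d (PowerSeries.X * f) = PowerSeries.X * seriesDeriv d f := by
  ext n
  cases n with
  | zero => rw [coeff_seriesDeriv]; simp
  | succ n =>
    rw [coeff_seriesDeriv, PowerSeries.coeff_succ_X_mul, PowerSeries.coeff_succ_X_mul,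
      coeff_seriesDeriv]

theorem derivative_seriesDeriv (d : Derivation ℂ A A) (f : PowerSeries A) :
    PowerSeries.derivative A (seriesDeriv d f) = seriesDeriv d (PowerSeries.derivative A f) := by
  ext n
  rw [coeff_seriesDeriv, PowerSeries.coeff_derivative, PowerSeries.coeff_derivative,
    coeff_seriesDeriv, ← Nat.cast_succ, mul_comm, mul_comm _ ((n.succ : ℕ) : A), ← nsmul_eq_mul,
    ← nsmul_eq_mul, map_nsmul]

theorem series_eq_zero_of_derivative_eq_mul {p U : PowerSeries A}
    (h : PowerSeries.derivative A U = p * U) (h₀ : PowerSeries.constantCoeff U = 0) : U = 0 := by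
  ext n
  rw [map_zero]
  induction n using Nat.strong_induction_on with
  | _ n ih =>
    cases n with
    | zero => simpa using h₀
    | succ n =>
      have hn := congrArg (PowerSeries.coeff n) h
      rw [PowerSeries.coeff_derivative, PowerSeries.coeff_mul] at hn
      rw [Finset.sum_eq_zero fun x hx => by
        rw [ih x.2 (by have := Finset.HasAntidiagonal.mem_antidiagonal.mp hx; omega),
          mul_zero]] at hn
      have hu : IsUnit ((n : A) + 1) := by
        have : ((n : A) + 1) = algebraMap ℂ A ((n : ℂ) + 1) := by simp
        rw [this]
        exact (IsUnit.mk0 _ (Nat.cast_add_one_ne_zero n)).map _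
      exact (hu.mul_left_eq_zero).mp hn

end SeriesDerivation

/-! ### Complete symmetric polynomials of the generic matrix -/

section MatrixPolynomials

variable {N : ℕ}

/-- The partial derivatives of polynomial functions on `gl(N)`. -/
noncomputable def polyDeriv (N : ℕ) (i j : Fin N) :
    Derivation ℂ (MvPolynomial (Fin N × Fin N) ℂ) (MvPolynomial (Fin N × Fin N) ℂ) :=
  MvPolynomial.pderiv (i, j)

theorem polyDeriv_comm (i j i' j' : Fin N) (p : MvPolynomial (Fin N × Fin N) ℂ) :
    polyDeriv N i j (polyDeriv N i' j' p) = polyDeriv N i' j' (polyDeriv N i j p) := by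
  have h : ⁅polyDeriv N i j, polyDeriv N i' j'⁆ = 0 := by
    refine MvPolynomial.derivation_ext fun v => ?_
    rw [Derivation.commutator_apply, polyDeriv, polyDeriv, MvPolynomial.pderiv_X,
      MvPolynomial.pderiv_X]
    simp only [Pi.single_apply, apply_ite (MvPolynomial.pderiv _), map_zero, ite_self,
      Derivation.map_one_eq_zero, sub_self, Derivation.coe_zero, Pi.zero_apply]
  rw [← sub_eq_zero, ← Derivation.commutator_apply, h]
  rfl

/-- The generic matrix. -/
noncomputable abbrev genMat (N : ℕ) :
    Matrix (Fin N) (Fin N) (MvPolynomial (Fin N × Fin N) ℂ) :=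
  Matrix.mvPolynomialX (Fin N) (Fin N) ℂ

theorem map_polyDeriv_genMat (i j : Fin N) :
    (genMat N).map (polyDeriv N i j) = Matrix.single i j 1 := by
  ext k l
  by_cases h : (k, l) = (i, j)
  · obtain ⟨rfl, rfl⟩ := Prod.mk.inj h
    simp [polyDeriv, Matrix.mvPolynomialX]
  · rw [Matrix.single_apply_of_ne _ _ _ _ _ fun h' => h (by rw [h'.1, h'.2])]
    simp only [Matrix.map_apply, Matrix.mvPolynomialX_apply, polyDeriv]
    rw [MvPolynomial.pderiv_X_of_ne h]

/-- The gradient of a function on matrices. -/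
def matGrad {a A : Type} [CommRing A] [Algebra ℂ A] (D : a → a → Derivation ℂ A A) (f : A) :
    Matrix a a A :=
  Matrix.of fun i j => D j i f

theorem map_derivation_mul {A K : Type} [CommRing A] [Algebra ℂ A] [Fintype K]
    (d : Derivation ℂ A A) (F G : Matrix K K A) :
    (F * G).map d = F.map d * G + F * G.map d := by
  ext i j
  simp only [Matrix.map_apply, Matrix.mul_apply, Matrix.add_apply, map_sum, Derivation.leibniz,
    smul_eq_mul, Finset.sum_add_distrib]
  rw [add_comm]
  congr 1
  exact Finset.sum_congr rfl fun _ _ => mul_comm _ _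

/-- Only `Y = 1` is needed, but the induction moves a factor `F` around the trace and absorbs it
into `Y`. -/
theorem trace_mul_map_pow {A K : Type} [CommRing A] [Algebra ℂ A] [Fintype K] [DecidableEq K]
    (d : Derivation ℂ A A) (F Y : Matrix K K A) (h : Commute F Y) (n : ℕ) :
    Matrix.trace (Y * (F ^ (n + 1)).map d) =
      ((n : A) + 1) * Matrix.trace (Y * F ^ n * F.map d) := by
  induction n generalizing Y with
  | zero => simp
  | succ n ih =>
    have h₁ : Matrix.trace (Y * ((F ^ (n + 1)).map d * F)) =
        ((n : A) + 1) * Matrix.trace (Y * F ^ (n + 1) * F.map d) := by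
      rw [← mul_assoc, Matrix.trace_mul_comm, ← mul_assoc, ih (F * Y) ((Commute.refl F).mul_right h),
        h.eq, mul_assoc Y, ← pow_succ']
    rw [pow_succ F (n + 1), map_derivation_mul, mul_add, Matrix.trace_add, h₁, ← mul_assoc]
    push_cast
    ring

theorem polyDeriv_trace_pow (i j : Fin N) (n : ℕ) :
    polyDeriv N i j (Matrix.trace (genMat N ^ (n + 1))) = ((n : MvPolynomial _ ℂ) + 1) *
      (genMat N ^ n) j i := by
  have h := trace_mul_map_pow (polyDeriv N i j) (genMat N) 1 (Commute.one_right _) n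
  rw [one_mul, one_mul, map_polyDeriv_genMat, Matrix.trace_mul_single, MulOpposite.op_one,
    one_smul] at h
  rw [← h, Matrix.trace, map_sum]
  rfl

/-- The complete symmetric polynomials of the generic matrix, by Newton's identities. -/
noncomputable def completePoly (N : ℕ) : ℕ → MvPolynomial (Fin N × Fin N) ℂ
  | 0 => 1
  | m + 1 => ((m : ℂ) + 1)⁻¹ •
      ∑ i : Fin (m + 1), Matrix.trace (genMat N ^ (i.1 + 1)) * completePoly N (m - i.1)

/-- The coefficients of `G(z) (1 - ε z X)⁻¹` for `G(z) = ∑ g_k z^k`. -/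
noncomputable def resolventSeq {A K : Type} [CommRing A] [Algebra ℂ A] [Fintype K] [DecidableEq K]
    (ε : ℂ) (X : Matrix K K A) (g : ℕ → A) : ℕ → Matrix K K A
  | 0 => g 0 • 1
  | m + 1 => g (m + 1) • 1 + ε • (X * resolventSeq ε X g m)

theorem resolventSeq_eq_sum {A K : Type} [CommRing A] [Algebra ℂ A] [Fintype K] [DecidableEq K]
    (ε : ℂ) (X : Matrix K K A) (g : ℕ → A) (m : ℕ) :
    resolventSeq ε X g m =
      ∑ p ∈ Finset.HasAntidiagonal.antidiagonal m, g p.2 • ε ^ p.1 • X ^ p.1 := by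
  induction m with
  | zero => simp [resolventSeq]
  | succ m ih =>
    rw [resolventSeq, ih, Finset.Nat.sum_antidiagonal_succ, Finset.mul_sum, Finset.smul_sum]
    simp only [pow_zero, one_smul]
    congr 1
    refine Finset.sum_congr rfl fun p _ => ?_
    rw [pow_succ' X, pow_succ' ε, mul_smul_comm, mul_smul_comm, smul_comm ε, smul_smul]

theorem derivative_mk_completePoly (N : ℕ) :
    PowerSeries.derivative _ (PowerSeries.mk (completePoly N)) =
      PowerSeries.mk (fun i => Matrix.trace (genMat N ^ (i + 1))) *
        PowerSeries.mk (completePoly N) := by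
  ext1 m
  rw [PowerSeries.coeff_derivative, PowerSeries.coeff_mul, PowerSeries.coeff_mk, completePoly,
    Finset.Nat.sum_antidiagonal_eq_sum_range_succ_mk, Finset.sum_range]
  simp only [PowerSeries.coeff_mk]
  have : ((m : MvPolynomial (Fin N × Fin N) ℂ) + 1) = algebraMap ℂ _ ((m : ℂ) + 1) := by simp
  rw [this, ← Algebra.commutes, ← Algebra.smul_def, smul_smul,
    mul_inv_cancel₀ (Nat.cast_add_one_ne_zero m), one_smul]

/-- With `G = ∑ h_k z^k` and `G' = p G`, both `∂G` and `z (1 - zX)⁻¹ G` (entrywise) satisfy `V' =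
(∂p) G + p V` with zero constant term, so they agree. -/
theorem matGrad_completePoly (m : ℕ) :
    matGrad (polyDeriv N) (completePoly N (m + 1)) =
      resolventSeq 1 (genMat N) (completePoly N) m := by
  ext1 k l
  let G := PowerSeries.mk (completePoly N)
  let p := PowerSeries.mk fun i => Matrix.trace (genMat N ^ (i + 1))
  let x := PowerSeries.mk fun i => (genMat N ^ i) k l
  have hG : PowerSeries.derivative _ G = p * G := derivative_mk_completePoly N
  have hp : seriesDeriv (polyDeriv N l k) p = PowerSeries.derivative _ (PowerSeries.X * x) := by
    ext1 n
    rw [coeff_seriesDeriv, PowerSeries.coeff_derivative, PowerSeries.coeff_succ_X_mul,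
      PowerSeries.coeff_mk, PowerSeries.coeff_mk, polyDeriv_trace_pow, mul_comm]
  have hU : seriesDeriv (polyDeriv N l k) G - PowerSeries.X * x * G = 0 := by
    refine series_eq_zero_of_derivative_eq_mul (p := p) ?_ ?_
    · rw [map_sub, derivative_seriesDeriv, hG, Derivation.leibniz, Derivation.leibniz, hG, hp,
        smul_eq_mul, smul_eq_mul, smul_eq_mul]
      ring
    · rw [← PowerSeries.coeff_zero_eq_constantCoeff_apply, map_sub, coeff_seriesDeriv]
      simp [G, completePoly]
  have h := congrArg (PowerSeries.coeff (m + 1)) (sub_eq_zero.mp hU)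
  rw [coeff_seriesDeriv, mul_assoc, PowerSeries.coeff_succ_X_mul, PowerSeries.coeff_mul] at h
  simp only [G, x, PowerSeries.coeff_mk] at h
  rw [resolventSeq_eq_sum, Matrix.sum_apply]
  change polyDeriv N l k _ = _
  rw [h]
  refine Finset.sum_congr rfl fun q _ => ?_
  simp [mul_comm]

/-- Evaluation of a polynomial function at a matrix. -/
noncomputable def evalMat (h : Matrix (Fin N) (Fin N) ℂ) :
    MvPolynomial (Fin N × Fin N) ℂ →ₐ[ℂ] ℂ :=
  MvPolynomial.aeval fun p => h p.1 p.2

theorem map_evalMat_genMat (h : Matrix (Fin N) (Fin N) ℂ) :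
    (genMat N).map (evalMat h) = h := by
  ext i j
  simp [evalMat, Matrix.mvPolynomialX]

theorem evalMat_trace_pow (h : Matrix (Fin N) (Fin N) ℂ) (n : ℕ) :
    evalMat h (Matrix.trace (genMat N ^ n)) = Matrix.trace (h ^ n) := by
  have : (genMat N ^ n).map (evalMat h) = h ^ n := by
    have e := map_pow (evalMat h).mapMatrix (genMat N) n
    rw [AlgHom.mapMatrix_apply, AlgHom.mapMatrix_apply, map_evalMat_genMat] at e
    exact e
  rw [← this, Matrix.trace, map_sum]
  rfl

/-- Newton's identities say that the generating series solves `G' = ξ' G`, `G(0) = 1`, as `exp ξ`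
does. -/
theorem evalMat_completePoly (h : Matrix (Fin N) (Fin N) ℂ) (m : ℕ) :
    evalMat h (completePoly N m) = completeSym (m : ℤ) h := by
  let ξ := xiSeries h
  let G := (PowerSeries.exp ℂ).subst ξ
  have h₀ : PowerSeries.constantCoeff ξ = 0 := by
    rw [← PowerSeries.coeff_zero_eq_constantCoeff_apply]
    simp [ξ, xiSeries]
  have hs : PowerSeries.HasSubst ξ := PowerSeries.HasSubst.of_constantCoeff_zero' h₀
  have hG : PowerSeries.derivative ℂ G = PowerSeries.derivative ℂ ξ * G := by
    rw [PowerSeries.derivative_subst hs, PowerSeries.derivative_exp, mul_comm]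
  have hG₀ : PowerSeries.constantCoeff G = 1 := by
    have e := PowerSeries.constantCoeff_subst hs (PowerSeries.exp ℂ)
    rw [finsum_eq_single _ 0 fun d hd => by
      have : MvPowerSeries.constantCoeff (ξ ^ d) = 0 := by
        rw [map_pow]
        exact (congrArg (· ^ d) h₀).trans (zero_pow hd)
      rw [this, smul_zero]] at e
    refine e.trans ?_
    simp
  let G' := PowerSeries.mk fun m => evalMat h (completePoly N m)
  have hξ : PowerSeries.derivative ℂ ξ = PowerSeries.mk fun i => Matrix.trace (h ^ (i + 1)) := by
    ext n
    rw [PowerSeries.coeff_derivative, PowerSeries.coeff_mk]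
    have : (n : ℂ) + 1 ≠ 0 := Nat.cast_add_one_ne_zero n
    simp [ξ, xiSeries]
    field_simp
  have hG' : PowerSeries.derivative ℂ G' = PowerSeries.derivative ℂ ξ * G' := by
    ext n
    have e := congrArg (fun f => evalMat h (PowerSeries.coeff n f)) (derivative_mk_completePoly N)
    simp only [PowerSeries.coeff_derivative, PowerSeries.coeff_mul, map_sum, map_mul,
      PowerSeries.coeff_mk, evalMat_trace_pow, map_add, map_natCast, map_one] at e
    rw [hξ, PowerSeries.coeff_derivative, PowerSeries.coeff_mul]
    simpa [G', PowerSeries.coeff_mk] using e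
  have key : G' - G = 0 := by
    refine series_eq_zero_of_derivative_eq_mul (p := PowerSeries.derivative ℂ ξ) ?_ ?_
    · rw [map_sub, hG, hG', mul_sub]
    · rw [map_sub, hG₀, ← PowerSeries.coeff_zero_eq_constantCoeff_apply, PowerSeries.coeff_mk]
      simp [completePoly]
  have e := congrArg (PowerSeries.coeff m) (sub_eq_zero.mp key)
  rw [PowerSeries.coeff_mk] at e
  rw [e, completeSym, if_neg (by omega)]
  rfl

end MatrixPolynomials

/-! ### Hook characters by the Pieri recursion -/

section Hooks

/-- The Jacobi-Trudi matrix of a hook, with an arbitrary first row. -/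
def hookToeplitz {R : Type} (H : ℤ → R) (x : ℕ → R) (β : ℕ) :
    Matrix (Fin (β + 1)) (Fin (β + 1)) R :=
  Matrix.of fun i j => Fin.cases (x j) (fun i' : Fin β => H ((j : ℤ) - (i' : ℤ))) i

/-- Below the first row, the first column is `1, 0, 0, …`, so its expansion has two terms. On hooks
this is the Pieri rule `s_(α+1, 1^(β+1)) = h_(α+1) e_(β+1) - s_(α+2, 1^β)`. -/
theorem det_hookToeplitz_succ {R : Type} [CommRing R] (H : ℤ → R) (h₀ : H 0 = 1)
    (hneg : ∀ k < 0, H k = 0) (x : ℕ → R) (β : ℕ) :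
    (hookToeplitz H x (β + 1)).det =
      x 0 * (hookToeplitz H (fun j => H ((j : ℤ) + 1)) β).det -
        (hookToeplitz H (fun j => x (j + 1)) β).det := by
  rw [Matrix.det_succ_column_zero, Fin.sum_univ_succ, Fin.sum_univ_succ,
    Finset.sum_eq_zero (s := Finset.univ) fun i _ => ?_, add_zero, sub_eq_add_neg]
  · congr 1
    · rw [Fin.val_zero, pow_zero, one_mul]
      congr 2
      ext i j
      refine Fin.cases ?_ (fun i => ?_) i
      · change H (((j.succ : Fin (β + 2)) : ℤ) - ((0 : Fin (β + 1)) : ℤ)) = _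
        simp [hookToeplitz]
      · simp [hookToeplitz]
    · have e : (hookToeplitz H x (β + 1)) (Fin.succ 0) 0 = 1 := by
        simp only [hookToeplitz, Matrix.of_apply, Fin.cases_succ]
        simpa using h₀
      rw [e, mul_one]
      simp only [Fin.val_succ, Fin.val_zero, zero_add, pow_one, neg_mul, one_mul]
      congr 2
      ext i j
      refine Fin.cases ?_ (fun i => ?_) i
      · simp [hookToeplitz]
      · simp [hookToeplitz]
  · have e : (hookToeplitz H x (β + 1)) i.succ.succ 0 = 0 := by
      simp only [hookToeplitz, Matrix.of_apply, Fin.cases_succ]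
      refine hneg _ ?_
      simp
      omega
    rw [e, mul_zero, zero_mul]

/-- The hook characters as polynomials. -/
noncomputable def hookPoly (N : ℕ) : ℕ → ℕ → MvPolynomial (Fin N × Fin N) ℂ
  | 0, α => completePoly N (α + 1)
  | β + 1, α => completePoly N (α + 1) * hookPoly N β 0 - hookPoly N β (α + 1)

theorem completeSym_zero {N : ℕ} (h : Matrix (Fin N) (Fin N) ℂ) : completeSym 0 h = 1 := by
  rw [← Nat.cast_zero, ← evalMat_completePoly, completePoly, map_one]

theorem schurChar_hookRows {N : ℕ} (h : Matrix (Fin N) (Fin N) ℂ) (α β : ℕ) :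
    schurChar (hookRows α β) h = evalMat h (hookPoly N β α) := by
  have e : ∀ α β, schurChar (hookRows α β) h =
      (hookToeplitz (completeSym · h) (fun j => completeSym ((j : ℤ) + α + 1) h) β).det := by
    intro α β
    rw [schurChar]
    congr 1
    ext i j
    refine Fin.cases ?_ (fun i => ?_) i
    · simp only [hookRows, hookToeplitz, Matrix.of_apply, Fin.cons_zero, Fin.cases_zero]
      congr 1
      push_cast
      simp
      ring
    · simp only [hookRows, hookToeplitz, Matrix.of_apply, Fin.cons_succ, Fin.cases_succ]
      congr 1
      push_cast
      simp
      ring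
  induction β generalizing α with
  | zero =>
    rw [e, hookPoly, evalMat_completePoly]
    refine (Matrix.det_fin_one _).trans ?_
    simp [hookToeplitz]
  | succ β ih =>
    rw [e, det_hookToeplitz_succ (completeSym · h) (completeSym_zero h) fun k hk => if_pos hk,
      hookPoly, map_sub, map_mul, ← ih, ← ih, e, e, evalMat_completePoly]
    congr 3
    · simp
    · ext j
      push_cast
      congr 1
      ring

end Hooks

/-! ### The swap operator and its absorption by co-derivatives -/

section SwapMatrix

variable {a A : Type} [CommRing A] [DecidableEq a]

/-- The permutation operator on two sites. -/
def swapMat (a A : Type) [CommRing A] [DecidableEq a] : Matrix (a × a) (a × a) A :=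
  (1 : Matrix (a × a) (a × a) A).submatrix Prod.swap id

variable [Fintype a]

theorem swapMat_mul (M : Matrix (a × a) (a × a) A) :
    swapMat a A * M = M.submatrix Prod.swap id := by
  ext p q
  simp [swapMat, Matrix.mul_apply, Matrix.one_apply]

theorem mul_swapMat (M : Matrix (a × a) (a × a) A) :
    M * swapMat a A = M.submatrix id Prod.swap := by
  have h : swapMat a A = (1 : Matrix (a × a) (a × a) A).submatrix id Prod.swap := by
    ext p q
    simp only [swapMat, Matrix.submatrix_apply, id, Matrix.one_apply]
    congr 1
    exact propext ⟨fun h => by rw [← h, Prod.swap_swap], fun h => by rw [h, Prod.swap_swap]⟩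
  ext p q
  simp [h, Matrix.mul_apply, Matrix.one_apply]

theorem swapMat_mul_self : swapMat a A * swapMat a A = 1 := by
  rw [mul_swapMat, swapMat]
  ext p q
  simp [Matrix.one_apply, Prod.swap_inj]

theorem swapMat_mul_kronecker (F G : Matrix a a A) :
    swapMat a A * (F ⊗ₖ G) = (G ⊗ₖ F) * swapMat a A := by
  rw [swapMat_mul, mul_swapMat]
  ext p q
  simp [mul_comm]

end SwapMatrix

section Gradient

variable {a A K : Type} [CommRing A] [Algebra ℂ A] (D : a → a → Derivation ℂ A A)

theorem matGrad_mul (f g : A) : matGrad D (f * g) = f • matGrad D g + g • matGrad D f := by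
  ext; simp [matGrad]

theorem matGrad_sub (f g : A) : matGrad D (f - g) = matGrad D f - matGrad D g := by
  ext; simp [matGrad]

theorem coder_smul' (f : A) (F : Matrix K K A) :
    coder D (f • F) = f • coder D F + F ⊗ₖ matGrad D f := by
  ext; simp [matGrad, coder_apply]

variable [Fintype K] [DecidableEq K]

theorem commute_resolventSeq (ε : ℂ) (X : Matrix K K A) (g : ℕ → A) (m : ℕ) :
    Commute X (resolventSeq ε X g m) := by
  induction m with
  | zero => exact (Commute.one_right X).smul_right _
  | succ m ih =>
    exact ((Commute.one_right X).smul_right _).add_right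
      (((Commute.refl X).mul_right ih).smul_right _)

variable [Fintype a] [DecidableEq a]

/-- In the recursion the terms `1 ⊗ R` and `ε (1 ⊗ R) P` are exchanged by `P` up to the factor `ε`,
as `ε² = 1`. Writing the product as `X R` suits multiplication by `P` on the right, and as `R X` on
the left. -/
theorem coder_resolventSeq_absorb {D : a → a → Derivation ℂ A A} {ε : ℂ} {X : Matrix a a A}
    {g : ℕ → A} (hε : ε * ε = 1) (hX : coder D X = swapMat a A) (h₀ : g 0 = 1)
    (hg : ∀ m, matGrad D (g (m + 1)) = resolventSeq ε X g m) (m : ℕ) :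
    coder D (resolventSeq ε X g m) * swapMat a A = ε • coder D (resolventSeq ε X g m) ∧
      swapMat a A * coder D (resolventSeq ε X g m) = ε • coder D (resolventSeq ε X g m) := by
  induction m with
  | zero => simp [resolventSeq, h₀, coder_one]
  | succ m ih =>
    have e₁ : coder D (resolventSeq ε X g (m + 1)) = 1 ⊗ₖ resolventSeq ε X g m +
        ε • ((1 ⊗ₖ resolventSeq ε X g m) * swapMat a A +
          (X ⊗ₖ 1) * coder D (resolventSeq ε X g m)) := by
      rw [resolventSeq, coder_add, coder_smul', coder_one, smul_zero, zero_add, hg, coder_smul,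
        coder_mul, hX, swapMat_mul_kronecker]
    have e₂ : coder D (resolventSeq ε X g (m + 1)) = 1 ⊗ₖ resolventSeq ε X g m +
        ε • (swapMat a A * (1 ⊗ₖ resolventSeq ε X g m) +
          coder D (resolventSeq ε X g m) * (X ⊗ₖ 1)) := by
      rw [resolventSeq, (commute_resolventSeq ε X g m).eq, coder_add, coder_smul', coder_one,
        smul_zero, zero_add, hg, coder_smul, coder_mul, hX, swapMat_mul_kronecker, add_comm (_ * _)]
    constructor
    · rw [e₁]
      simp only [add_mul, smul_mul_assoc, mul_assoc, swapMat_mul_self, ih.1, smul_add, smul_smul,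
        hε, one_smul, mul_smul_comm, mul_one]
      abel
    · rw [e₂]
      simp only [mul_add, mul_smul_comm, ← mul_assoc, swapMat_mul_self, ih.2, smul_add, smul_smul,
        hε, one_smul, smul_mul_assoc, one_mul]
      abel

end Gradient

/-! ### Factorised gradients of hook characters -/

section HookGradient

variable {N : ℕ}

theorem coder_genMat : coder (polyDeriv N) (genMat N) = swapMat (Fin N) _ := by
  ext ⟨k, i⟩ ⟨k', j⟩
  have h := congrFun₂ (map_polyDeriv_genMat j i) k k'
  rw [Matrix.map_apply] at h
  rw [coder_apply, h, swapMat, Matrix.submatrix_apply, Matrix.one_apply, Matrix.single_apply]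
  congr 1
  simp [Prod.ext_iff, and_comm, eq_comm]

/-- The elementary symmetric polynomials of the generic matrix. -/
noncomputable def elemPoly (N : ℕ) : ℕ → MvPolynomial (Fin N × Fin N) ℂ
  | 0 => 1
  | m + 1 => hookPoly N m 0

/-- The co-derivatives of the one-row characters. -/
noncomputable abbrev rowGrad (N : ℕ) (α : ℕ) :
    Matrix (Fin N) (Fin N) (MvPolynomial (Fin N × Fin N) ℂ) :=
  resolventSeq 1 (genMat N) (completePoly N) α

/-- The co-derivatives of the one-column characters. -/
noncomputable abbrev colGrad (N : ℕ) (β : ℕ) :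
    Matrix (Fin N) (Fin N) (MvPolynomial (Fin N × Fin N) ℂ) :=
  resolventSeq (-1) (genMat N) (elemPoly N) β

theorem completePoly_zero (N : ℕ) : completePoly N 0 = 1 := by
  rw [completePoly]

theorem rowGrad_zero : rowGrad N 0 = 1 := by
  simp [rowGrad, resolventSeq, completePoly]

theorem colGrad_zero : colGrad N 0 = 1 := by
  simp [colGrad, resolventSeq, elemPoly]

/-- Differentiating the Pieri recursion gives `h_(α+1) C_β + e_(β+1) R_α - R_(α+1) C_β`. Since
`R_(α+1) = h_(α+1) + R_α X`, this is `R_α (e_(β+1) - X C_β) = R_α C_(β+1)`. -/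
theorem matGrad_hookPoly (α β : ℕ) :
    matGrad (polyDeriv N) (hookPoly N β α) = rowGrad N α * colGrad N β := by
  induction β generalizing α with
  | zero => rw [hookPoly, matGrad_completePoly, colGrad_zero, mul_one]
  | succ β ih =>
    have hc : colGrad N (β + 1) = hookPoly N β 0 • 1 - genMat N * colGrad N β := by
      rw [colGrad, resolventSeq, neg_one_smul, sub_eq_add_neg, elemPoly]
    have hr : rowGrad N (α + 1) = completePoly N (α + 1) • 1 + rowGrad N α * genMat N := by
      rw [rowGrad, resolventSeq, one_smul, (commute_resolventSeq _ _ _ _).eq]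
    rw [hookPoly, matGrad_sub, matGrad_mul, ih, ih, rowGrad_zero, one_mul, matGrad_completePoly,
      hc, hr, mul_sub, add_mul, smul_mul_assoc, one_mul, mul_smul_comm, mul_one, mul_assoc]
    abel

theorem matGrad_elemPoly (m : ℕ) :
    matGrad (polyDeriv N) (elemPoly N (m + 1)) = colGrad N m := by
  rw [elemPoly, matGrad_hookPoly, rowGrad_zero, one_mul]

theorem coder_swapMat {a A : Type} [CommRing A] [Algebra ℂ A] [DecidableEq a]
    (D : a → a → Derivation ℂ A A) : coder D (swapMat a A) = 0 := by
  ext p q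
  by_cases h : p.1.swap = q.1 <;> simp [coder_apply, swapMat, Matrix.one_apply, h]

theorem coder_rowGrad_mul_coder_colGrad (α β m : ℕ) :
    TwistedCommuteAt (polyDeriv N) 0 m (coder (polyDeriv N) (rowGrad N α))
      (coder (polyDeriv N) (colGrad N β)) := by
  have hr := coder_resolventSeq_absorb (one_mul 1) coder_genMat (completePoly_zero N)
    (matGrad_completePoly (N := N)) α
  have hc := coder_resolventSeq_absorb (by norm_num) coder_genMat rfl
    (matGrad_elemPoly (N := N)) β
  rw [one_smul] at hr
  rw [neg_one_smul] at hc
  exact twistedCommuteAt_zero_of_absorb _ m (coder_swapMat _) hr.1 hc.2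

/-- In this order the absorbed constant is minus the swap. -/
theorem coder_colGrad_mul_coder_rowGrad (α β m : ℕ) :
    TwistedCommuteAt (polyDeriv N) 0 m (coder (polyDeriv N) (colGrad N β))
      (coder (polyDeriv N) (rowGrad N α)) := by
  have hr := coder_resolventSeq_absorb (one_mul 1) coder_genMat (completePoly_zero N)
    (matGrad_completePoly (N := N)) α
  have hc := coder_resolventSeq_absorb (by norm_num) coder_genMat rfl
    (matGrad_elemPoly (N := N)) β
  rw [one_smul] at hr
  rw [neg_one_smul] at hc
  refine twistedCommuteAt_zero_of_absorb (C := -swapMat _ _) _ m ?_ ?_ ?_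
  · rw [coder_neg, coder_swapMat, neg_zero]
  · rw [mul_neg, hc.1, neg_neg]
  · rw [neg_mul, hr.2]

theorem commute_rowGrad_colGrad (α β : ℕ) : Commute (rowGrad N α) (colGrad N β) := by
  suffices h : ∀ Y : Matrix (Fin N) (Fin N) _, Commute (genMat N) Y → Commute (rowGrad N α) Y from
    h _ (commute_resolventSeq _ _ _ _)
  intro Y hY
  rw [rowGrad, resolventSeq_eq_sum]
  exact Commute.sum_left _ _ _ fun p _ => ((hY.pow_left _).smul_left _).smul_left _

end HookGradient

/-! ### Constant matrices, coefficients of series, tensor products -/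

section Constants

variable {a A K : Type} [CommRing A] [Algebra ℂ A]

/-- A constant matrix over an algebra. -/
def constMat (A : Type) [CommRing A] [Algebra ℂ A] (F : Matrix K K ℂ) : Matrix K K A :=
  F.map (algebraMap ℂ A)

theorem coder_constMat (D : a → a → Derivation ℂ A A) (F : Matrix K K ℂ) :
    coder D (constMat A F) = 0 := by
  ext; simp [coder_apply, constMat]

theorem constMat_add (F G : Matrix K K ℂ) :
    constMat A (F + G) = constMat A F + constMat A G := by
  ext; simp [constMat]

theorem constMat_smul (c : ℂ) (F : Matrix K K ℂ) :
    constMat A (c • F) = c • constMat A F := by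
  ext; simp [constMat, Algebra.smul_def]

theorem constMat_mul [Fintype K] (F G : Matrix K K ℂ) :
    constMat A (F * G) = constMat A F * constMat A G :=
  Matrix.map_mul

theorem constMat_one [DecidableEq K] : constMat A (1 : Matrix K K ℂ) = 1 :=
  Matrix.map_one _ (map_zero _) (map_one _)

theorem constMat_kronecker {L : Type} (F : Matrix K K ℂ) (G : Matrix L L ℂ) :
    constMat A (F ⊗ₖ G) = constMat A F ⊗ₖ constMat A G := by
  ext; simp [constMat]

theorem constMat_submatrix {L : Type} (e : L → K) (F : Matrix K K ℂ) :
    constMat A (F.submatrix e e) = (constMat A F).submatrix e e := rfl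

theorem constMat_swapMat [DecidableEq a] : constMat A (swapMat a ℂ) = swapMat a A := by
  ext p q
  by_cases h : p.swap = q <;> simp [constMat, swapMat, Matrix.one_apply, h]

end Constants

section Coefficients

variable {A K L : Type} [CommRing A]

/-- The coefficients of a matrix of power series. -/
noncomputable def coeffMat (n : ℕ) (F : Matrix K K (PowerSeries A)) : Matrix K K A :=
  F.map (PowerSeries.coeff n)

theorem coeffMat_mul_constMat [Algebra ℂ A] [Fintype K] (n : ℕ)
    (F : Matrix K K (PowerSeries A)) (C : Matrix K K ℂ) :
    coeffMat n (F * constMat _ C) = coeffMat n F * constMat A C := by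
  ext i j
  simp [coeffMat, constMat, Matrix.mul_apply, PowerSeries.algebraMap_apply,
    PowerSeries.coeff_mul_C]

theorem coeffMat_constMat_mul [Algebra ℂ A] [Fintype K] (n : ℕ)
    (F : Matrix K K (PowerSeries A)) (C : Matrix K K ℂ) :
    coeffMat n (constMat _ C * F) = constMat A C * coeffMat n F := by
  ext i j
  simp [coeffMat, constMat, Matrix.mul_apply, PowerSeries.algebraMap_apply,
    PowerSeries.coeff_C_mul]

theorem coeffMat_smul (n : ℕ) (f : PowerSeries A) (F : Matrix K K (PowerSeries A)) :
    coeffMat n (f • F) = ∑ p ∈ Finset.HasAntidiagonal.antidiagonal n,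
      PowerSeries.coeff p.1 f • coeffMat p.2 F := by
  ext i j
  simp [coeffMat, PowerSeries.coeff_mul, Matrix.sum_apply]

theorem coeffMat_kronecker (n : ℕ) (F : Matrix K K (PowerSeries A))
    (G : Matrix L L (PowerSeries A)) :
    coeffMat n (F ⊗ₖ G) = ∑ p ∈ Finset.HasAntidiagonal.antidiagonal n,
      coeffMat p.1 F ⊗ₖ coeffMat p.2 G := by
  ext i j
  simp [coeffMat, PowerSeries.coeff_mul, Matrix.sum_apply]

variable [Fintype K] [Fintype L]

/-- The coefficients of the series `F` commute with each other. -/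
def CoeffsCommute (F : Matrix K K (PowerSeries A)) : Prop :=
  ∀ p q, Commute (coeffMat p F) (coeffMat q F)

theorem CoeffsCommute.kronecker {F : Matrix K K (PowerSeries A)}
    {G : Matrix L L (PowerSeries A)} (hF : CoeffsCommute F) (hG : CoeffsCommute G) :
    CoeffsCommute (F ⊗ₖ G) := by
  intro p q
  rw [coeffMat_kronecker, coeffMat_kronecker]
  refine Commute.sum_left _ _ _ fun i _ => Commute.sum_right _ _ _ fun j _ => ?_
  rw [commute_iff_eq, ← Matrix.mul_kronecker_mul, ← Matrix.mul_kronecker_mul, (hF _ _).eq,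
    (hG _ _).eq]

/-- A constant commuting with a series commutes with each coefficient. -/
theorem CoeffsCommute.smul_mul_constMat [Algebra ℂ A] {F : Matrix K K (PowerSeries A)}
    (hF : CoeffsCommute F) {C : Matrix K K ℂ} (hC : Commute (constMat _ C) F)
    (f : PowerSeries A) : CoeffsCommute (f • (F * constMat _ C)) := by
  have hc : ∀ n, Commute (constMat A C) (coeffMat n F) := by
    intro n
    rw [commute_iff_eq, ← coeffMat_mul_constMat, ← coeffMat_constMat_mul, hC.eq]
  intro p q
  rw [coeffMat_smul, coeffMat_smul]
  refine Commute.sum_left _ _ _ fun i _ => Commute.sum_right _ _ _ fun j _ => ?_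
  refine (Commute.smul_left ?_ _).smul_right _
  rw [coeffMat_mul_constMat, coeffMat_mul_constMat]
  exact ((hF _ _).mul_left (hc _)).mul_right ((hc _).symm.mul_left (Commute.refl _))

end Coefficients

section Kronecker

variable {a A K : Type} [CommRing A]

theorem kronecker_submatrix_siteSwap (W : Matrix K K A) (w : Matrix a a A) :
    ((W ⊗ₖ w) ⊗ₖ w).submatrix (siteSwap K a) (siteSwap K a) = (W ⊗ₖ w) ⊗ₖ w := by
  ext
  simp [siteSwap, mul_right_comm]

theorem commute_submatrix [Fintype K] {L : Type} [Fintype L] {F G : Matrix K K A}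
    (h : Commute F G) (e : L ≃ K) : Commute (F.submatrix e e) (G.submatrix e e) := by
  rw [commute_iff_eq, Matrix.submatrix_mul_equiv, Matrix.submatrix_mul_equiv, h.eq]

theorem commute_kronecker [Fintype K] [Fintype a] {F F' : Matrix K K A} {G G' : Matrix a a A}
    (h : Commute F F') (h' : Commute G G') : Commute (F ⊗ₖ G) (F' ⊗ₖ G') := by
  rw [commute_iff_eq, ← Matrix.mul_kronecker_mul, ← Matrix.mul_kronecker_mul, h.eq, h'.eq]

theorem kronecker_submatrix_prodAssoc {L : Type} (W : Matrix K K A) (w : Matrix a a A)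
    (v : Matrix L L A) :
    (W ⊗ₖ (w ⊗ₖ v)).submatrix (Equiv.prodAssoc K a L) (Equiv.prodAssoc K a L) =
      (W ⊗ₖ w) ⊗ₖ v := by
  ext
  simp [mul_assoc]

variable [DecidableEq a] [DecidableEq K]

/-- The matrix of the permutation operators between the last site and all other sites. -/
def extendSwap (e : Matrix (K × a) (K × a) ℂ) :
    Matrix ((K × a) × a) ((K × a) × a) ℂ :=
  (e ⊗ₖ (1 : Matrix a a ℂ)).submatrix (siteSwap K a) (siteSwap K a) +
    ((1 : Matrix K K ℂ) ⊗ₖ swapMat a ℂ).submatrix (Equiv.prodAssoc K a a) (Equiv.prodAssoc K a a)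

theorem constMat_extendSwap [Algebra ℂ A] (e : Matrix (K × a) (K × a) ℂ) :
    constMat A (extendSwap e) =
      (constMat A e ⊗ₖ (1 : Matrix a a A)).submatrix (siteSwap K a) (siteSwap K a) +
      ((1 : Matrix K K A) ⊗ₖ swapMat a A).submatrix (Equiv.prodAssoc K a a)
        (Equiv.prodAssoc K a a) := by
  rw [extendSwap, constMat_add, constMat_submatrix, constMat_submatrix, constMat_kronecker,
    constMat_kronecker, constMat_one, constMat_one, constMat_swapMat]

end Kronecker

/-! ### Iterated co-derivatives of the generating series -/

section Fusion

variable {a A K : Type} [CommRing A] [Algebra ℂ A] [Fintype a] [Fintype K]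

/-- Constants `c` and `e` through which the co-derivatives of `G W c` are obtained from those of
`G` when `W` is a tensor power of `w`, with `d G = z G w` and `d w = ε z (w ⊗ w) P`. -/
structure FusionData (D : a → a → Derivation ℂ (PowerSeries A) (PowerSeries A)) (ε : ℂ)
    (w : Matrix a a (PowerSeries A)) (F : Matrix K K (PowerSeries A)) where
  G : PowerSeries A
  W : Matrix K K (PowerSeries A)
  c : Matrix K K ℂ
  e : Matrix (K × a) (K × a) ℂ
  eq_smul : F = G • (W * constMat _ c)
  grad_G : matGrad D G = (PowerSeries.X * G) • w
  coder_W : coder D W = (ε • (PowerSeries.X : PowerSeries A)) • ((W ⊗ₖ w) * constMat _ e)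
  commute_e : Commute (constMat _ e) (W ⊗ₖ w)
  commute_c : Commute (constMat _ c) W
  coeffs_W : CoeffsCommute W

theorem FusionData.coeffsCommute {D : a → a → Derivation ℂ (PowerSeries A) (PowerSeries A)}
    {ε : ℂ} {w : Matrix a a (PowerSeries A)} {F : Matrix K K (PowerSeries A)}
    (S : FusionData D ε w F) : CoeffsCommute F := by
  rw [S.eq_smul]
  exact S.coeffs_W.smul_mul_constMat S.commute_c _

variable [DecidableEq a] [DecidableEq K]

theorem commute_extendSwap {e : Matrix (K × a) (K × a) ℂ} {W : Matrix K K A} {w : Matrix a a A}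
    (h : Commute (constMat A e) (W ⊗ₖ w)) :
    Commute (constMat A (extendSwap e)) ((W ⊗ₖ w) ⊗ₖ w) := by
  rw [constMat_extendSwap]
  refine Commute.add_left ?_ ?_
  · rw [← kronecker_submatrix_siteSwap]
    exact commute_submatrix (commute_kronecker h (Commute.one_left _)) _
  · rw [← kronecker_submatrix_prodAssoc]
    refine commute_submatrix (commute_kronecker (Commute.one_left _) ?_) _
    exact swapMat_mul_kronecker w w

/-- By Leibniz, each tensor factor contributes its swap with the new site; the sum of these swaps is
`extendSwap e`. -/
theorem coder_kronecker_of_coder {D : a → a → Derivation ℂ A A} {z : A} {W : Matrix K K A}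
    {w : Matrix a a A} {e : Matrix (K × a) (K × a) ℂ}
    (hw : coder D w = z • ((w ⊗ₖ w) * swapMat a A))
    (hW : coder D W = z • ((W ⊗ₖ w) * constMat A e)) :
    coder D (W ⊗ₖ w) = z • (((W ⊗ₖ w) ⊗ₖ w) * constMat A (extendSwap e)) := by
  have h₁ : W ⊗ₖ w = (W ⊗ₖ (1 : Matrix a a A)) * ((1 : Matrix K K A) ⊗ₖ w) := by
    rw [← Matrix.mul_kronecker_mul, mul_one, one_mul]
  have h₂ : coder D ((1 : Matrix K K A) ⊗ₖ w) =
      ((1 : Matrix K K A) ⊗ₖ coder D w).submatrix (Equiv.prodAssoc K a a)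
        (Equiv.prodAssoc K a a) := by
    ext ⟨⟨k, i⟩, j⟩ ⟨⟨k', i'⟩, j'⟩
    by_cases h : k = k' <;> simp [coder_apply, h]
  have h₃ : ((1 : Matrix K K A) ⊗ₖ w) ⊗ₖ (1 : Matrix a a A) =
      ((1 : Matrix (K × a) (K × a) A) ⊗ₖ w).submatrix (siteSwap K a) (siteSwap K a) := by
    ext ⟨⟨k, i⟩, j⟩ ⟨⟨k', i'⟩, j'⟩
    by_cases hk : k = k' <;> by_cases hj : j = j' <;> simp [siteSwap, hk, hj]
  have h₄ : (W ⊗ₖ (1 : Matrix a a A)) ⊗ₖ (1 : Matrix a a A) =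
      (W ⊗ₖ (1 : Matrix (a × a) (a × a) A)).submatrix (Equiv.prodAssoc K a a)
        (Equiv.prodAssoc K a a) := by
    rw [← Matrix.one_kronecker_one, kronecker_submatrix_prodAssoc]
  have h₅ : coder D (W ⊗ₖ (1 : Matrix a a A)) * (((1 : Matrix K K A) ⊗ₖ w) ⊗ₖ 1) =
      z • (((W ⊗ₖ w) ⊗ₖ w) *
        (constMat A e ⊗ₖ (1 : Matrix a a A)).submatrix (siteSwap K a) (siteSwap K a)) := by
    rw [coder_kronecker_one, h₃, Matrix.submatrix_mul_equiv, hW, Matrix.smul_kronecker,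
      ← kronecker_submatrix_siteSwap, Matrix.submatrix_mul_equiv, smul_mul_assoc,
      ← Matrix.mul_kronecker_mul, ← Matrix.mul_kronecker_mul, one_mul, mul_one, mul_one]
    rfl
  have h₆ : ((W ⊗ₖ (1 : Matrix a a A)) ⊗ₖ 1) * coder D ((1 : Matrix K K A) ⊗ₖ w) =
      z • (((W ⊗ₖ w) ⊗ₖ w) * ((1 : Matrix K K A) ⊗ₖ swapMat a A).submatrix
        (Equiv.prodAssoc K a a) (Equiv.prodAssoc K a a)) := by
    rw [h₂, h₄, Matrix.submatrix_mul_equiv, hw, Matrix.kronecker_smul,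
      ← kronecker_submatrix_prodAssoc, Matrix.submatrix_mul_equiv, mul_smul_comm,
      ← Matrix.mul_kronecker_mul, ← Matrix.mul_kronecker_mul, one_mul, mul_one]
    rfl
  conv_lhs => rw [h₁]
  rw [coder_mul, h₅, h₆, ← smul_add, ← mul_add, constMat_extendSwap]

variable {d : a → a → Derivation ℂ A A}

/-- The co-derivative of a fused matrix is fused. -/
noncomputable def FusionData.coder {ε : ℂ} {w : Matrix a a (PowerSeries A)}
    {F : Matrix K K (PowerSeries A)} (S : FusionData (fun i j => seriesDeriv (d i j)) ε w F)
    (hw : coder (fun i j => seriesDeriv (d i j)) w =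
      (ε • (PowerSeries.X : PowerSeries A)) • ((w ⊗ₖ w) * swapMat a _))
    (hc : CoeffsCommute w) :
    FusionData (fun i j => seriesDeriv (d i j)) ε w
      (_root_.coder (fun i j => seriesDeriv (d i j)) F) where
  G := PowerSeries.X * S.G
  W := S.W ⊗ₖ w
  -- In the derivative of `G W c`, the summand `1` comes from `dG = z G w` and `ε e` from `dW`.
  c := (1 + ε • S.e) * (S.c ⊗ₖ 1)
  e := extendSwap S.e
  eq_smul := by
    have h : (S.W * constMat _ S.c) ⊗ₖ w = (S.W ⊗ₖ w) * (constMat _ S.c ⊗ₖ 1) := by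
      rw [← Matrix.mul_kronecker_mul, mul_one]
    conv_lhs => rw [S.eq_smul]
    rw [coder_smul', S.grad_G, coder_mul, coder_constMat, mul_zero, add_zero, S.coder_W,
      Matrix.kronecker_smul, h, constMat_mul, constMat_add, constMat_smul, constMat_one,
      constMat_kronecker, constMat_one, add_mul, mul_add, one_mul, smul_mul_assoc, smul_smul,
      smul_add, add_comm, smul_mul_assoc, mul_smul_comm, mul_assoc, mul_smul_comm, smul_assoc,
      mul_comm S.G]
    congr 1
    rw [smul_comm]
  grad_G := by
    ext1 i j
    have h := congrFun₂ S.grad_G i j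
    change seriesDeriv (d j i) (PowerSeries.X * S.G) = _
    rw [seriesDeriv_X_mul, Matrix.smul_apply, smul_eq_mul, mul_assoc PowerSeries.X]
    exact congrArg _ h
  coder_W := coder_kronecker_of_coder hw S.coder_W
  commute_e := commute_extendSwap S.commute_e
  commute_c := by
    rw [constMat_mul, constMat_add, constMat_smul, constMat_one, constMat_kronecker, constMat_one]
    exact ((Commute.one_left _).add_left (S.commute_e.smul_left _)).mul_left
      (commute_kronecker S.commute_c (Commute.one_left _))
  coeffs_W := S.coeffs_W.kronecker hc

theorem FusionData.twistedCommuteAt {ε : ℂ} {w : Matrix a a (PowerSeries A)}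
    (hw : _root_.coder (fun i j => seriesDeriv (d i j)) w =
      (ε • (PowerSeries.X : PowerSeries A)) • ((w ⊗ₖ w) * swapMat a _))
    (hc : CoeffsCommute w) (m p q : ℕ) {K : Type} [Fintype K] [DecidableEq K]
    {F : Matrix K K (PowerSeries A)} (S : FusionData (fun i j => seriesDeriv (d i j)) ε w F) :
    TwistedCommuteAt d 1 m (coeffMat p F) (coeffMat q F) := by
  induction m generalizing K with
  | zero =>
    change _ = (1 : ℂ) • _
    rw [one_smul]
    exact S.coeffsCommute p q
  | succ m ih =>
    have h : ∀ n, _root_.coder d (coeffMat n F) =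
        coeffMat n (_root_.coder (fun i j => seriesDeriv (d i j)) F) := by
      intro n
      ext
      exact (coeff_seriesDeriv ..).symm
    change TwistedCommuteAt d 1 m (_root_.coder d _) (_root_.coder d _)
    rw [h, h]
    exact ih (S.coder hw hc)

/-- The resolventSeries `(1 - ε z X)⁻¹`. -/
noncomputable def resolventSeries (ε : ℂ) (X : Matrix a a A) : Matrix a a (PowerSeries A) :=
  Matrix.of fun i j => PowerSeries.mk fun n => (ε ^ n • X ^ n) i j

theorem coeffMat_resolventSeries (ε : ℂ) (X : Matrix a a A) (n : ℕ) :
    coeffMat n (resolventSeries ε X) = ε ^ n • X ^ n := by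
  ext
  simp [coeffMat, resolventSeries]

theorem coeffsCommute_resolventSeries (ε : ℂ) (X : Matrix a a A) :
    CoeffsCommute (resolventSeries ε X) := by
  intro p q
  rw [coeffMat_resolventSeries, coeffMat_resolventSeries]
  exact ((Commute.pow_pow_self X p q).smul_left _).smul_right _

theorem coeffMat_smul_resolventSeries (ε : ℂ) (X : Matrix a a A) (g : ℕ → A) (n : ℕ) :
    coeffMat n (PowerSeries.mk g • resolventSeries ε X) = resolventSeq ε X g n := by
  rw [coeffMat_smul, resolventSeq_eq_sum, ← Finset.Nat.sum_antidiagonal_swap]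
  refine Finset.sum_congr rfl fun p _ => ?_
  rw [coeffMat_resolventSeries, PowerSeries.coeff_mk]
  rfl

/-- The matrix `1 - ε z X`. -/
noncomputable def resolventInv (ε : ℂ) (X : Matrix a a A) : Matrix a a (PowerSeries A) :=
  1 - (ε • (PowerSeries.X : PowerSeries A)) • X.map PowerSeries.C

theorem resolventInv_mul_resolventSeries (ε : ℂ) (X : Matrix a a A) :
    resolventInv ε X * resolventSeries ε X = 1 := by
  have h : resolventSeries ε X = 1 + (ε • (PowerSeries.X : PowerSeries A)) •
      (X.map PowerSeries.C * resolventSeries ε X) := by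
    ext i j n
    have hs : PowerSeries.coeff n (((1 : Matrix a a (PowerSeries A)) +
        (ε • (PowerSeries.X : PowerSeries A)) • (X.map PowerSeries.C * resolventSeries ε X)) i j) =
        PowerSeries.coeff n ((1 : Matrix a a (PowerSeries A)) i j) + ε •
          PowerSeries.coeff n (PowerSeries.X * (X.map PowerSeries.C * resolventSeries ε X) i j) := by
      rw [Matrix.add_apply, Matrix.smul_apply, map_add, smul_eq_mul, smul_mul_assoc]
      rfl
    rw [hs]
    cases n with
    | zero =>
      by_cases hij : i = j <;> simp [resolventSeries, Matrix.one_apply, hij]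
    | succ n =>
      rw [PowerSeries.coeff_succ_X_mul]
      have h₁ : PowerSeries.coeff (n + 1) ((1 : Matrix a a (PowerSeries A)) i j) = 0 := by
        by_cases hij : i = j <;> simp [Matrix.one_apply, hij, PowerSeries.coeff_one]
      have h₂ : PowerSeries.coeff n ((X.map PowerSeries.C * resolventSeries ε X) i j) =
          (ε ^ n • (X * X ^ n)) i j := by
        simp [Matrix.mul_apply, resolventSeries, PowerSeries.coeff_C_mul, Finset.smul_sum]
      rw [h₁, h₂, zero_add]
      simp [resolventSeries, pow_succ', smul_smul]
  rw [resolventInv, sub_mul, one_mul, smul_mul_assoc]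
  exact sub_eq_of_eq_add h

/-- Differentiate `(1 - εzX) w = 1`, using that `dX` is the swap, and solve for `dw`. -/
theorem coder_resolventSeries {X : Matrix a a A} (hX : _root_.coder d X = swapMat a A) (ε : ℂ) :
    _root_.coder (fun i j => seriesDeriv (d i j)) (resolventSeries ε X) =
      (ε • (PowerSeries.X : PowerSeries A)) •
        ((resolventSeries ε X ⊗ₖ resolventSeries ε X) * swapMat a _) := by
  have h₁ := resolventInv_mul_resolventSeries ε X
  have h₂ : resolventSeries ε X * resolventInv ε X = 1 := mul_eq_one_comm.mp h₁
  have h₃ : _root_.coder (fun i j => seriesDeriv (d i j)) (resolventInv ε X) =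
      -((ε • (PowerSeries.X : PowerSeries A)) • swapMat a _) := by
    ext1 p q
    have hx : seriesDeriv (d q.2 p.2) (PowerSeries.C (X p.1 q.1)) = swapMat a _ p q := by
      have hx' := congrFun₂ hX p q
      ext n
      rw [coeff_seriesDeriv, PowerSeries.coeff_C, apply_ite (d q.2 p.2), map_zero]
      rw [coder_apply] at hx'
      rw [hx']
      by_cases hpq : p.swap = q <;> simp [swapMat, Matrix.one_apply, hpq, PowerSeries.coeff_one]
    have ho : seriesDeriv (d q.2 p.2) ((1 : Matrix a a (PowerSeries A)) p.1 q.1) = 0 := by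
      by_cases hpq : p.1 = q.1 <;> simp [Matrix.one_apply, hpq]
    rw [coder_apply, resolventInv, Matrix.sub_apply, map_sub, ho, zero_sub, Matrix.neg_apply,
      Matrix.smul_apply, Matrix.smul_apply, smul_eq_mul, smul_eq_mul, smul_mul_assoc,
      Derivation.map_smul, Matrix.map_apply, seriesDeriv_X_mul, hx, smul_mul_assoc]
  have h₄ := coder_mul (fun i j => seriesDeriv (d i j)) (resolventInv ε X) (resolventSeries ε X)
  rw [h₁, coder_one, h₃, neg_mul, eq_comm, neg_add_eq_zero] at h₄
  have h₅ := congrArg ((resolventSeries ε X ⊗ₖ 1) * ·) h₄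
  simp only [← mul_assoc, ← Matrix.mul_kronecker_mul, h₂, one_mul, Matrix.one_kronecker_one] at h₅
  rw [← h₅, mul_smul_comm, smul_mul_assoc, mul_assoc, swapMat_mul_kronecker, ← mul_assoc,
    ← Matrix.mul_kronecker_mul, one_mul, mul_one]

theorem twistedCommuteAt_resolventSeq {X : Matrix a a A} {ε : ℂ} {g : ℕ → A}
    (hX : _root_.coder d X = swapMat a A) (h₀ : g 0 = 1)
    (hg : ∀ m, matGrad d (g (m + 1)) = resolventSeq ε X g m) (m p q : ℕ) :
    TwistedCommuteAt d 1 m (resolventSeq ε X g p) (resolventSeq ε X g q) := by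
  rw [← coeffMat_smul_resolventSeries, ← coeffMat_smul_resolventSeries]
  refine FusionData.twistedCommuteAt (coder_resolventSeries hX ε)
    (coeffsCommute_resolventSeries ε X) m p q
    { G := PowerSeries.mk g
      W := resolventSeries ε X
      c := 1
      e := swapMat a ℂ
      eq_smul := ?_
      grad_G := ?_
      coder_W := ?_
      commute_e := ?_
      commute_c := ?_
      coeffs_W := coeffsCommute_resolventSeries ε X }
  · rw [constMat_one, mul_one]
  · ext i j n
    change PowerSeries.coeff n (seriesDeriv (d j i) (PowerSeries.mk g)) = _
    rw [coeff_seriesDeriv, PowerSeries.coeff_mk, Matrix.smul_apply, smul_eq_mul, mul_assoc]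
    cases n with
    | zero => simp [h₀]
    | succ n =>
      rw [PowerSeries.coeff_succ_X_mul]
      refine (congrFun₂ (hg n) i j).trans ?_
      rw [← coeffMat_smul_resolventSeries]
      rfl
  · rw [constMat_swapMat, coder_resolventSeries hX]
  · rw [constMat_swapMat]
    exact swapMat_mul_kronecker _ _
  · rw [constMat_one]
    exact Commute.one_left _

end Fusion

/-! ### From polynomials to operators at a given twist -/

section Evaluation

variable {N : ℕ}

theorem hasDerivAt_evalMat (h : Matrix (Fin N) (Fin N) ℂ) (i j : Fin N)
    (p : MvPolynomial (Fin N × Fin N) ℂ) :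
    HasDerivAt (fun ε : ℂ => evalMat (h + ε • Matrix.single i j (1 : ℂ)) p)
      (evalMat h (polyDeriv N i j p)) 0 := by
  induction p using MvPolynomial.induction_on with
  | C c =>
    simpa [evalMat, polyDeriv] using hasDerivAt_const (0 : ℂ) c
  | add p q hp hq =>
    simp only [map_add]
    exact hp.add hq
  | mul_X p v hp =>
    have hX : HasDerivAt (fun ε : ℂ => evalMat (h + ε • Matrix.single i j (1 : ℂ))
        (MvPolynomial.X v)) (evalMat h (polyDeriv N i j (MvPolynomial.X v))) 0 := by
      have e : evalMat h (polyDeriv N i j (MvPolynomial.X v)) =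
          Matrix.single i j (1 : ℂ) v.1 v.2 := by
        have e' : polyDeriv N i j (MvPolynomial.X v) = Matrix.single i j 1 v.1 v.2 :=
          congrFun₂ (map_polyDeriv_genMat i j) v.1 v.2
        rw [e', Matrix.single_apply, Matrix.single_apply, apply_ite (evalMat h), map_one, map_zero]
      rw [e]
      simp only [evalMat, MvPolynomial.aeval_X, Matrix.add_apply, Matrix.smul_apply, smul_eq_mul]
      simpa using ((hasDerivAt_id (0 : ℂ)).mul_const
        (Matrix.single i j (1 : ℂ) v.1 v.2)).const_add (h v.1 v.2)
    have hm := hp.mul hX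
    simp only [zero_smul, add_zero] at hm
    simp only [map_mul, Derivation.leibniz, smul_eq_mul, map_add]
    rw [add_comm, mul_comm (evalMat h (MvPolynomial.X v))]
    exact hm

theorem siteProduct_evalMat (x : ℂ) (p : MvPolynomial (Fin N × Fin N) ℂ) (n : ℕ) (xs : Fin n → ℂ)
    (h : Matrix (Fin N) (Fin N) ℂ) (I J : Fin n → Fin N) :
    siteProduct x (fun h => evalMat h p) n xs h I J =
      evalMat h (siteOperator (polyDeriv N) n (fun i => (x - xs i)⁻¹) I J p) := by
  induction n generalizing h with
  | zero =>
    rw [Subsingleton.elim I J]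
    simp [siteProduct, siteOperator]
  | succ n ih =>
    have hu : Fin.init (fun i => (x - xs i)⁻¹) = fun i => (x - (Fin.init xs : Fin n → ℂ) i)⁻¹ := rfl
    simp only [siteProduct, siteOperator, tensorOne, coDeriv, Matrix.add_apply, Matrix.smul_apply,
      Matrix.of_apply, ih, (hasDerivAt_evalMat ..).deriv, hu]
    by_cases hIJ : I (Fin.last n) = J (Fin.last n) <;>
      simp [Matrix.one_apply, hIJ]

/-- Splitting off the last site, placing it in front. -/
def frontSite (a : Type) (n : ℕ) : (Fin (n + 1) → a) ≃ a × (Fin n → a) where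
  toFun I := (I (Fin.last n), Fin.init I)
  invFun p := Fin.snoc p.2 p.1
  left_inv I := by simp
  right_inv p := by simp

/-- Evaluation of a matrix of polynomials, as an operator on `n + 1` sites. -/
noncomputable def evalSites (n : ℕ) (h : Matrix (Fin N) (Fin N) ℂ) :
    Matrix (Fin N × (Fin n → Fin N)) (Fin N × (Fin n → Fin N)) (MvPolynomial (Fin N × Fin N) ℂ) →+*
      SiteOp N (n + 1) :=
  (Matrix.reindexAlgEquiv ℂ ℂ (frontSite (Fin N) n).symm).toRingHom.comp
    (evalMat h).mapMatrix.toRingHom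

/-- The last co-derivative commutes past the site operators and becomes the gradient of the hook
character, whose site is moved to the front by `frontSite`. -/
theorem hookCoDerivMatrix_eq {n : ℕ} (x : ℂ) (xs : Fin n → ℂ) (h : Matrix (Fin N) (Fin N) ℂ)
    (α β : ℕ) :
    hookCoDerivMatrix x xs h α β =
      evalSites n h (siteChain (polyDeriv N) n (fun i => (x - xs i)⁻¹) (rowGrad N α)) *
      evalSites n h (siteChain (polyDeriv N) n (fun i => (x - xs i)⁻¹) (colGrad N β)) := by
  rw [← map_mul, ← siteChain_mul _ polyDeriv_comm _ _ (coder_rowGrad_mul_coder_colGrad α β),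
    ← matGrad_hookPoly]
  ext I J
  have hs : schurChar (hookRows α β) = fun h : Matrix (Fin N) (Fin N) ℂ =>
    evalMat h (hookPoly N β α) := funext fun h => schurChar_hookRows h α β
  simp only [hookCoDerivMatrix, Matrix.of_apply, coDeriv, gaudinT, hs, siteProduct_evalMat,
    (hasDerivAt_evalMat ..).deriv, siteOperator_comm _ polyDeriv_comm]
  rfl

theorem commute_rows_columns {n : ℕ} (x : ℂ) (xs : Fin n → ℂ) (h : Matrix (Fin N) (Fin N) ℂ)
    (α β : ℕ) :
    Commute (evalSites n h (siteChain (polyDeriv N) n (fun i => (x - xs i)⁻¹) (rowGrad N α)))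
      (evalSites n h (siteChain (polyDeriv N) n (fun i => (x - xs i)⁻¹) (colGrad N β))) := by
  refine Commute.map ?_ _
  rw [commute_iff_eq,
    ← siteChain_mul _ polyDeriv_comm _ _ (coder_rowGrad_mul_coder_colGrad α β),
    ← siteChain_mul _ polyDeriv_comm _ _ (coder_colGrad_mul_coder_rowGrad α β),
    (commute_rowGrad_colGrad α β).eq]

theorem commute_siteChain_resolventSeq {n : ℕ} (u : Fin n → ℂ) {ε : ℂ}
    {g : ℕ → MvPolynomial (Fin N × Fin N) ℂ} (h₀ : g 0 = 1)
    (hg : ∀ m, matGrad (polyDeriv N) (g (m + 1)) = resolventSeq ε (genMat N) g m) (p q : ℕ) :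
    Commute (siteChain (polyDeriv N) n u (resolventSeq ε (genMat N) g p))
      (siteChain (polyDeriv N) n u (resolventSeq ε (genMat N) g q)) :=
  (twistedCommuteAt_siteChain (polyDeriv N) polyDeriv_comm 1 0 n u fun m =>
    twistedCommuteAt_resolventSeq coder_genMat h₀ hg m p q).trans (one_smul _ _)

end Evaluation

theorem mainTheorem4 (N : ℕ) (hN : 0 < N) (n : ℕ) (x : ℂ) (xs : Fin n → ℂ)
    (hx : ∀ i, x ≠ xs i) (h : Matrix (Fin N) (Fin N) ℂ) :
    (∀ α β α' β' : ℕ,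
      Commute (hookCoDerivMatrix x xs h α β) (hookCoDerivMatrix x xs h α' β')) ∧
    (∃ α β : ℕ, IsUnit (hookCoDerivMatrix x xs h α β)) ∧
    (∀ α₁ α₂ β₁ β₂ : ℕ,
      hookCoDerivMatrix x xs h α₁ β₁ * hookCoDerivMatrix x xs h α₂ β₂ -
        hookCoDerivMatrix x xs h α₁ β₂ * hookCoDerivMatrix x xs h α₂ β₁ = 0) := by
  set u : Fin n → ℂ := fun i => (x - xs i)⁻¹ with hu
  let P α := evalSites n h (siteChain (polyDeriv N) n u (rowGrad N α))
  let Q β := evalSites n h (siteChain (polyDeriv N) n u (colGrad N β))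
  have hM : ∀ α β, hookCoDerivMatrix x xs h α β = P α * Q β := hookCoDerivMatrix_eq x xs h
  have hPQ : ∀ α β, Commute (P α) (Q β) := commute_rows_columns x xs h
  have hP : ∀ α α', Commute (P α) (P α') := fun α α' =>
    (commute_siteChain_resolventSeq u (completePoly_zero N) matGrad_completePoly α α').map _
  have hQ : ∀ β β', Commute (Q β) (Q β') := fun β β' =>
    (commute_siteChain_resolventSeq u rfl matGrad_elemPoly β β').map _
  refine ⟨fun α β α' β' => ?_, ⟨0, 0, ?_⟩, fun α₁ α₂ β₁ β₂ => ?_⟩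
  · rw [hM, hM]
    exact ((hP _ _).mul_right (hPQ _ _)).mul_left ((hPQ _ _).symm.mul_right (hQ _ _))
  · have hP₀ : P 0 = 1 := by
      simp only [P, rowGrad_zero, siteChain_one, map_one]
    have hQ₀ : Q 0 = 1 := by
      simp only [Q, colGrad_zero, siteChain_one, map_one]
    rw [hM, hP₀, hQ₀, mul_one]
    exact isUnit_one
  · have hc : ∀ β β', P α₁ * Q β * (P α₂ * Q β') = P α₁ * P α₂ * (Q β * Q β') := fun β β' =>
      (hPQ α₂ β).symm.mul_mul_mul_comm _ _
    rw [hM, hM, hM, hM, hc, hc, (hQ β₁ β₂).eq, sub_self]
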